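/- Let $(E_n)_{n\ge 0}$ be the Euler numbers, defined by $E_0=1$, $E_{2n-1}=0$ and $\sum_{r=0}^{n}\binom{2n}{2r}E_{2r}=0$ for $n=1,2,3,\ldots$. Let $b\ge 0$ be an even integer, and let $k\ge 1$ and $m\ge 5$ be integers. Then $$E_{2^mk+b}\equiv\begin{cases} E_b-11\cdot 2^mk \pmod{2^{m+5}} & \text{if } b\equiv 0,14 \pmod{16},\\ E_b+13\cdot 2^mk \pmod{2^{m+5}} & \text{if } b\equiv 2,12 \pmod{16},\\ E_b-3\cdot 2^mk \pmod{2^{m+5}} & \text{if } b\equiv 4,10 \pmod{16},\\ E_b+5\cdot 2^mk \pmod{2^{m+5}} & \text{if } b\equiv 6,8 \pmod{16}. \end{cases}$$ -/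

import Mathlib

/-- The Euler numbers `E₀ = 1, E₁ = 0, E₂ = -1, E₃ = 0, E₄ = 5, …`: `E₀ = 1`, `Eₙ = 0` for odd `n`,
and `∑_{r = 0}^{n} C(2n, 2r) E_{2r} = 0` for `n ≥ 1`, solved here for the last term. -/
def eulerNumber : ℕ → ℤ
  | 0 => 1
  | n + 1 =>
    if Even (n + 1) then
      -∑ r : Fin ((n + 1) / 2), ((n + 1).choose (2 * (r : ℕ)) : ℤ) * eulerNumber (2 * (r : ℕ))
    else 0
termination_by n => n
decreasing_by have := r.isLt; omega

theorem eulerNumber_zero : eulerNumber 0 = 1 := by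
  rw [eulerNumber]

theorem eulerNumber_odd (n : ℕ) (hn : 1 ≤ n) : eulerNumber (2 * n - 1) = 0 := by
  obtain ⟨m, rfl⟩ : ∃ m, n = m + 1 := ⟨n - 1, by omega⟩
  have h : 2 * (m + 1) - 1 = 2 * m + 1 := by omega
  rw [h, eulerNumber, if_neg (by simp)]

/-- The defining recurrence of the Euler numbers. -/
theorem sum_choose_mul_eulerNumber (n : ℕ) (hn : 1 ≤ n) :
    ∑ r ∈ Finset.range (n + 1), ((2 * n).choose (2 * r) : ℤ) * eulerNumber (2 * r) = 0 := by
  obtain ⟨m, rfl⟩ : ∃ m, n = m + 1 := ⟨n - 1, by omega⟩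
  have key : eulerNumber (2 * (m + 1)) =
      -∑ r ∈ Finset.range (m + 1),
        ((2 * (m + 1)).choose (2 * r) : ℤ) * eulerNumber (2 * r) := by
    have h : 2 * (m + 1) = 2 * m + 1 + 1 := by omega
    have h2 : (2 * m + 1 + 1) / 2 = m + 1 := by omega
    rw [h, eulerNumber, if_pos ⟨m + 1, by omega⟩, h2,
      Fin.sum_univ_eq_sum_range
        (fun r => ((2 * m + 1 + 1).choose (2 * r) : ℤ) * eulerNumber (2 * r))]
  rw [Finset.sum_range_succ, Nat.choose_self, key]
  simp

/-! Let L be the functional X^n ↦ E_n. The values Δ^i = L((X² - 1)^i X^(2r)) are the forward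
differences of r ↦ E_{2r}, so E_{2(r+N)} = Σ C(N,i) Δ^i. Since L sends Newton polynomials with odd
nodes to signed factorials, Δ^i is highly divisible by 2. If 2^m ∣ N with m ≥ 4, the terms i ≥ 5
vanish mod 2^(m+6), and those with i ≤ 4 give 3(E_{2(r+N)} - E_{2r}) ≡ N(8r(r+1) - 2)
(`three_mul_eulerNumber_sub`). For b = 2r and 2N = 2^m k, dividing by 3 leaves a multiple of 2^m k
whose coefficient depends only on r(r+1) mod 8. This is invariant under r ↦ 7 - r, whence the four
pairs of classes. -/

open Polynomial

/-! ### The umbral functional and its shift relation -/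

/-- The umbral functional sending `X ^ n` to the `n`-th Euler number. -/
noncomputable def eulerFunctional : ℤ[X] →ₗ[ℤ] ℤ :=
  (Polynomial.basisMonomials ℤ).constr ℤ eulerNumber

theorem eulerFunctional_X_pow (n : ℕ) : eulerFunctional (X ^ n) = eulerNumber n := by
  have h := (Polynomial.basisMonomials ℤ).constr_basis ℤ eulerNumber n
  rw [coe_basisMonomials] at h
  rwa [← monomial_one_right_eq_X_pow]

theorem eulerFunctional_intCast_mul (c : ℤ) (f : ℤ[X]) :
    eulerFunctional ((c : ℤ[X]) * f) = c * eulerFunctional f := by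
  rw [← zsmul_eq_mul, map_zsmul, smul_eq_mul]

theorem eulerNumber_of_odd {n : ℕ} (hn : Odd n) : eulerNumber n = 0 := by
  obtain ⟨p, rfl⟩ := hn
  exact eulerNumber_odd (p + 1) (by omega)

theorem sum_range_eq_sum_even {M : Type*} [AddCommMonoid M] (f : ℕ → M)
    (hf : ∀ n, Odd n → f n = 0) (p : ℕ) :
    ∑ k ∈ Finset.range (2 * p + 1), f k = ∑ r ∈ Finset.range (p + 1), f (2 * r) := by
  induction p with
  | zero => simp
  | succ p ih =>
    rw [show 2 * (p + 1) + 1 = 2 * p + 1 + 1 + 1 by ring, Finset.sum_range_succ,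
      Finset.sum_range_succ, ih, hf (2 * p + 1) ⟨p, rfl⟩, add_zero, Finset.sum_range_succ _ (p + 1)]
    rfl

theorem eulerFunctional_add_pow (c : ℤ) (n : ℕ) :
    eulerFunctional ((X + (c : ℤ[X])) ^ n) =
      ∑ k ∈ Finset.range (n + 1), c ^ (n - k) * (n.choose k : ℤ) * eulerNumber k := by
  rw [add_pow, map_sum]
  refine Finset.sum_congr rfl fun k _ => ?_
  rw [← eulerFunctional_X_pow, ← eulerFunctional_intCast_mul]
  congr 1
  push_cast
  ring

/-- The defining recurrence in umbral form; `0 ^ n` accounts for n = 0. -/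
theorem eulerFunctional_X_pow_shift (n : ℕ) :
    eulerFunctional ((X + 1) ^ n) + eulerFunctional ((X - 1) ^ n) = 2 * 0 ^ n := by
  have h1 := eulerFunctional_add_pow 1 n
  have h2 := eulerFunctional_add_pow (-1) n
  rw [Int.cast_one] at h1
  rw [Int.cast_neg, Int.cast_one, ← sub_eq_add_neg] at h2
  rw [h1, h2, ← Finset.sum_add_distrib]
  rcases Nat.even_or_odd' n with ⟨p, rfl | rfl⟩
  · rw [sum_range_eq_sum_even _ fun k hk => by simp [eulerNumber_of_odd hk]]
    have h3 : ∀ r ∈ Finset.range (p + 1),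
        (1 : ℤ) ^ (2 * p - 2 * r) * ((2 * p).choose (2 * r) : ℤ) * eulerNumber (2 * r) +
          (-1) ^ (2 * p - 2 * r) * ((2 * p).choose (2 * r) : ℤ) * eulerNumber (2 * r) =
        2 * (((2 * p).choose (2 * r) : ℤ) * eulerNumber (2 * r)) := by
      intro r _
      rw [← Nat.mul_sub, pow_mul (-1 : ℤ)]
      norm_num
      ring
    rw [Finset.sum_congr rfl h3, ← Finset.mul_sum]
    rcases Nat.eq_zero_or_pos p with rfl | hp
    · simp [eulerNumber_zero]
    · rw [sum_choose_mul_eulerNumber p hp, zero_pow (by omega)]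
  · rw [zero_pow (by omega), mul_zero]
    refine Finset.sum_eq_zero fun k hk => ?_
    rcases Nat.even_or_odd k with he | ho
    · have hk' : k ≤ 2 * p + 1 := by
        rw [Finset.mem_range] at hk
        omega
      have : Odd (2 * p + 1 - k) := Nat.Odd.sub_even hk' (by simp) he
      rw [this.neg_one_pow]
      ring
    · simp [eulerNumber_of_odd ho]

theorem eulerFunctional_comp_shift (f : ℤ[X]) :
    eulerFunctional (f.comp (X + 1)) + eulerFunctional (f.comp (X - 1)) = 2 * f.eval 0 := by
  induction f using Polynomial.induction_on' with
  | add p q hp hq =>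
    simp only [add_comp, map_add, eval_add]
    linarith
  | monomial n a =>
    have h := eulerFunctional_X_pow_shift n
    rw [monomial_comp, monomial_comp, eval_monomial, eq_intCast (C : ℤ →+* ℤ[X]),
      eulerFunctional_intCast_mul, eulerFunctional_intCast_mul, ← mul_add, h]
    ring

theorem eulerFunctional_comp_add_two (f : ℤ[X]) :
    eulerFunctional (f.comp (X + 2)) + eulerFunctional f = 2 * f.eval 1 := by
  have h := eulerFunctional_comp_shift (f.comp (X + 1))
  rw [comp_assoc, comp_assoc] at h
  have h1 : (X + 1 : ℤ[X]).comp (X + 1) = X + 2 := by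
    simp only [add_comp, X_comp, one_comp]
    ring
  have h2 : (X + 1 : ℤ[X]).comp (X - 1) = X := by
    simp
  rw [h1, h2, comp_X] at h
  simpa using h

/-! ### Newton basis and 2-divisibility of moments -/

/-- The Newton basis `∏_{i < j} (X - (2 i + 1))` with nodes at the odd numbers. -/
noncomputable def oddNewton : ℕ → ℤ[X]
  | 0 => 1
  | j + 1 => oddNewton j * (X - 1 - 2 * (j : ℤ[X]))

theorem oddNewton_succ (j : ℕ) : oddNewton (j + 1) = oddNewton j * (X - 1 - 2 * (j : ℤ[X])) := rfl

theorem oddNewton_succ_comp (j : ℕ) : (oddNewton (j + 1)).comp (X + 2) = (X + 1) * oddNewton j := by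
  induction j with
  | zero =>
    simp [oddNewton]
    ring
  | succ j ih =>
    rw [oddNewton_succ (j + 1), mul_comp, ih, oddNewton_succ j]
    simp
    ring

theorem eval_one_oddNewton_succ (j : ℕ) : (oddNewton (j + 1)).eval 1 = 0 := by
  induction j with
  | zero => simp [oddNewton]
  | succ j ih => rw [oddNewton_succ, eval_mul, ih, zero_mul]

/-- Write P_j for the basis. The shift by 2 turns P_{j+1} into (X + 1)P_j = P_{j+1} + 2(j+1)P_j, and
P_{j+1}(1) = 0, so L(P_{j+1}) = -(j+1) L(P_j). -/
theorem eulerFunctional_oddNewton (j : ℕ) :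
    eulerFunctional (oddNewton j) = (-1) ^ j * (j.factorial : ℤ) := by
  induction j with
  | zero =>
    have h := eulerFunctional_X_pow 0
    rw [pow_zero, eulerNumber_zero] at h
    simpa [oddNewton] using h
  | succ j ih =>
    have h := eulerFunctional_comp_add_two (oddNewton (j + 1))
    have h2 : (X + 1) * oddNewton j = oddNewton (j + 1) + ((2 * (j + 1) : ℤ) : ℤ[X]) * oddNewton j := by
      rw [oddNewton_succ]
      push_cast
      ring
    rw [oddNewton_succ_comp, eval_one_oddNewton_succ, h2, map_add, eulerFunctional_intCast_mul,
      ih] at h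
    rw [Nat.factorial_succ, pow_succ]
    push_cast
    linarith

/-- The values of the Euler functional on `(X ^ 2 - 1) ^ l * oddNewton j`. -/
def eulerMoment : ℕ → ℕ → ℤ
  | 0, j => (-1) ^ j * (j.factorial : ℤ)
  | l + 1, j => eulerMoment l (j + 2) + 4 * (j + 1) * eulerMoment l (j + 1) +
      4 * j * (j + 1) * eulerMoment l j

theorem eulerFunctional_pow_mul_oddNewton (l j : ℕ) :
    eulerFunctional ((X ^ 2 - 1) ^ l * oddNewton j) = eulerMoment l j := by
  induction l generalizing j with
  | zero => simp [eulerMoment, eulerFunctional_oddNewton]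
  | succ l ih =>
    have h : (X ^ 2 - 1) ^ (l + 1) * oddNewton j = (X ^ 2 - 1) ^ l * oddNewton (j + 2) +
        ((4 * (j + 1) : ℤ) : ℤ[X]) * ((X ^ 2 - 1) ^ l * oddNewton (j + 1)) +
        ((4 * j * (j + 1) : ℤ) : ℤ[X]) * ((X ^ 2 - 1) ^ l * oddNewton j) := by
      rw [oddNewton_succ (j + 1), oddNewton_succ j]
      push_cast
      ring
    rw [h, map_add, map_add, eulerFunctional_intCast_mul, eulerFunctional_intCast_mul, ih, ih, ih,
      eulerMoment]

theorem two_pow_half_dvd_factorial (j : ℕ) : 2 ^ (j / 2) ∣ j.factorial := by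
  induction j using Nat.twoStepInduction with
  | zero => simp
  | one => simp
  | more n ih _ =>
    have h : 2 ∣ (n + 2) * (n + 1) := by
      rw [mul_comm]
      exact (Nat.even_mul_succ_self (n + 1)).two_dvd
    rw [Nat.factorial_succ, Nat.factorial_succ, ← mul_assoc, Nat.add_div_right n two_pos, pow_succ,
      mul_comm]
    exact mul_dvd_mul h ih |>.trans (by simp)

/-- In the recurrence, raising j by 2 gains a factor 2, and the other two terms carry a factor 4. -/
theorem two_pow_dvd_eulerMoment (l j : ℕ) : (2 : ℤ) ^ (l + j / 2) ∣ eulerMoment l j := by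
  induction l generalizing j with
  | zero =>
    rw [eulerMoment, zero_add]
    exact Dvd.dvd.mul_left (mod_cast two_pow_half_dvd_factorial j) _
  | succ l ih =>
    have h1 := ih (j + 2)
    have h2 := mul_dvd_mul_left 2 ((pow_dvd_pow 2 (by omega)).trans (ih (j + 1)) :
      (2 : ℤ) ^ (l + j / 2) ∣ _)
    have h3 := mul_dvd_mul_left 2 (ih j)
    rw [← pow_succ'] at h2 h3
    rw [show l + (j + 2) / 2 = l + j / 2 + 1 by omega] at h1
    rw [eulerMoment, show l + 1 + j / 2 = l + j / 2 + 1 by omega]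
    refine dvd_add (dvd_add h1 ?_) ?_
    · exact (h2.mul_left (2 * (j + 1))).trans (dvd_of_eq (by ring))
    · exact (h3.mul_left (2 * j * (j + 1))).trans (dvd_of_eq (by ring))

/-! ### Forward differences and their residues -/

/-- The `i`-th forward difference of `r ↦ eulerNumber (2 * r)`. -/
noncomputable def eulerDiff (i r : ℕ) : ℤ := eulerFunctional ((X ^ 2 - 1) ^ i * X ^ (2 * r))

theorem eulerDiff_zero_left (r : ℕ) : eulerDiff 0 r = eulerNumber (2 * r) := by
  rw [eulerDiff, pow_zero, one_mul, eulerFunctional_X_pow]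

theorem eulerDiff_zero_right (i : ℕ) : eulerDiff i 0 = eulerMoment i 0 := by
  rw [← eulerFunctional_pow_mul_oddNewton, eulerDiff]
  simp [oddNewton]

theorem eulerDiff_succ_right (i r : ℕ) :
    eulerDiff i (r + 1) = eulerDiff i r + eulerDiff (i + 1) r := by
  rw [eulerDiff, eulerDiff, eulerDiff, ← map_add]
  congr 1
  ring

theorem eulerNumber_two_mul_add (r N : ℕ) :
    eulerNumber (2 * (r + N)) =
      ∑ l ∈ Finset.range (N + 1), (N.choose l : ℤ) * eulerDiff l r := by
  have h : (X : ℤ[X]) ^ (2 * (r + N)) = ((X ^ 2 - 1) + 1) ^ N * X ^ (2 * r) := by ring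
  rw [← eulerFunctional_X_pow, h, add_pow, Finset.sum_mul, map_sum]
  refine Finset.sum_congr rfl fun l _ => ?_
  rw [eulerDiff, ← eulerFunctional_intCast_mul]
  congr 1
  push_cast
  ring

/-- Δ^i at r is a combination of the Δ^l at 0 with l ≥ i, so bounds valid for all large l transfer
from 0 to every r. -/
theorem dvd_eulerDiff {d : ℤ} {s : ℕ} (h : ∀ i, s ≤ i → d ∣ eulerMoment i 0) (r i : ℕ)
    (hi : s ≤ i) : d ∣ eulerDiff i r := by
  induction r generalizing i with
  | zero => exact eulerDiff_zero_right i ▸ h i hi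
  | succ r ih => exact eulerDiff_succ_right i r ▸ dvd_add (ih i hi) (ih (i + 1) (by omega))

theorem two_pow_dvd_eulerDiff (i r : ℕ) : (2 : ℤ) ^ i ∣ eulerDiff i r :=
  dvd_eulerDiff (s := i) (fun l hl => (pow_dvd_pow 2 hl).trans
    (by simpa using two_pow_dvd_eulerMoment l 0)) r i le_rfl

theorem two_pow_eight_dvd_eulerDiff (i r : ℕ) (hi : 5 ≤ i) : (2 : ℤ) ^ 8 ∣ eulerDiff i r := by
  refine dvd_eulerDiff (s := 5) (fun l hl => ?_) r i hi
  rcases le_or_gt 8 l with h | h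
  · exact (pow_dvd_pow 2 h).trans (by simpa using two_pow_dvd_eulerMoment l 0)
  -- For l = 5, 6, 7 the general bound 2^l is too weak; the moments are computed exactly.
  · interval_cases l <;> decide +kernel

theorem two_pow_nine_dvd_eulerDiff (i r : ℕ) (hi : 6 ≤ i) : (2 : ℤ) ^ 9 ∣ eulerDiff i r := by
  refine dvd_eulerDiff (s := 6) (fun l hl => ?_) r i hi
  rcases le_or_gt 9 l with h | h
  · exact (pow_dvd_pow 2 h).trans (by simpa using two_pow_dvd_eulerMoment l 0)
  · interval_cases l <;> decide +kernel

/-- Here and below, Δ^i is needed mod 2^(6+v) with v the 2-adic valuation of i, because C(N,i) may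
lose v factors of 2 relative to N. -/
theorem eulerDiff_four_modEq (r : ℕ) : eulerDiff 4 r ≡ 128 [ZMOD 256] := by
  induction r with
  | zero =>
    rw [eulerDiff_zero_right]
    decide +kernel
  | succ r ih =>
    have h := two_pow_eight_dvd_eulerDiff 5 r le_rfl
    rw [eulerDiff_succ_right]
    simp only [Nat.reduceAdd]
    simp only [Int.ModEq] at *
    omega

theorem eulerDiff_three_modEq (r : ℕ) : eulerDiff 3 r ≡ -16 [ZMOD 64] := by
  induction r with
  | zero =>
    rw [eulerDiff_zero_right]
    decide +kernel
  | succ r ih =>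
    have h := eulerDiff_four_modEq r
    rw [eulerDiff_succ_right]
    simp only [Nat.reduceAdd]
    simp only [Int.ModEq] at *
    omega

theorem eulerDiff_two_modEq (r : ℕ) : eulerDiff 2 r ≡ 8 - 80 * r [ZMOD 128] := by
  -- Δ^3 is constant mod 128 because Δ^4 ≡ 0 there, so Δ^2 is linear in r.
  suffices h : eulerDiff 2 r ≡ 8 - 80 * r [ZMOD 128] ∧ eulerDiff 3 r ≡ -80 [ZMOD 128] from h.1
  induction r with
  | zero =>
    rw [eulerDiff_zero_right, eulerDiff_zero_right]
    decide +kernel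
  | succ r ih =>
    have h := eulerDiff_four_modEq r
    rw [eulerDiff_succ_right, eulerDiff_succ_right]
    push_cast
    simp only [Int.ModEq] at *
    omega

theorem eulerDiff_one_modEq (r : ℕ) :
    eulerDiff 1 r ≡ -2 + 8 * r - 40 * (r * (r - 1)) [ZMOD 64] := by
  induction r with
  | zero =>
    rw [eulerDiff_zero_right]
    decide +kernel
  | succ r ih =>
    have h := eulerDiff_two_modEq r
    have h' : ((r + 1 : ℕ) : ℤ) * ((r + 1 : ℕ) - 1) = r * (r - 1) + 2 * r := by
      push_cast
      ring
    rw [eulerDiff_succ_right, h']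
    generalize (r : ℤ) * (r - 1) = q at *
    push_cast
    simp only [Int.ModEq] at *
    omega

/-! ### The binomial tail and the main congruence -/

theorem two_pow_dvd_choose_mul {m N i e v o : ℕ} {d : ℤ} (hN : 2 ^ m ∣ N) (hi : i = 2 ^ v * o)
    (ho : Odd o) (he : v + 6 ≤ e) (hd : (2 : ℤ) ^ e ∣ d) :
    (2 : ℤ) ^ (m + 6) ∣ (N.choose i : ℤ) * d := by
  have h1 : 2 ^ m ∣ N.choose i * 2 ^ v := by
    rcases i with _ | i
    · have : o ≠ 0 := by rintro rfl; simp at ho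
      simp_all
    rcases N with _ | N
    · simp
    -- The absorption identity i C(N,i) = N C(N-1,i-1); the odd part of i then cancels.
    have h := Nat.add_one_mul_choose_eq N i
    have h2 : 2 ^ m ∣ (N + 1).choose (i + 1) * 2 ^ v * o := by
      rw [mul_assoc, ← hi, ← h]
      exact hN.mul_right _
    exact (Nat.Coprime.pow_left m (Nat.coprime_two_left.2 ho)).dvd_of_dvd_mul_right h2
  have h3 : (2 : ℤ) ^ (v + 6) ∣ d := (pow_dvd_pow 2 he).trans hd
  obtain ⟨q, rfl⟩ := h3
  have h4 : (2 : ℤ) ^ m ∣ (N.choose i : ℤ) * 2 ^ v := mod_cast h1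
  obtain ⟨p, hp⟩ := h4
  refine ⟨p * q, ?_⟩
  calc (N.choose i : ℤ) * (2 ^ (v + 6) * q) = (N.choose i * 2 ^ v) * (2 ^ 6 * q) := by ring
    _ = 2 ^ (m + 6) * (p * q) := by rw [hp]; ring

theorem two_pow_dvd_choose_mul_eulerDiff {m N i : ℕ} (hN : 2 ^ m ∣ N) (hi : 5 ≤ i) (r : ℕ) :
    (2 : ℤ) ^ (m + 6) ∣ (N.choose i : ℤ) * eulerDiff i r := by
  obtain ⟨v, o, ho, hvo⟩ := Nat.exists_eq_two_pow_mul_odd (n := i) (by omega)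
  have hle : 2 ^ v ≤ i := Nat.le_of_dvd (by omega) ⟨o, hvo⟩
  -- For v ≥ 4, i ≥ 2^v ≥ v + 6 and the bound 2^i suffices; smaller v needs the sharper bounds 2^8
  -- and 2^9.
  have hv : v + 6 ≤ i ∨ v ≤ 3 := by
    rcases le_or_gt v 3 with h | h
    · exact Or.inr h
    · obtain ⟨w, rfl⟩ := Nat.exists_eq_add_of_le h
      have := Nat.lt_two_pow_self (n := w)
      rw [pow_add] at hle
      omega
  have hv2 : i < 8 → v ≤ 2 := fun h => by
    by_contra! h'
    have := Nat.pow_le_pow_right two_pos h'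
    omega
  rcases lt_or_ge i 8 with h | h
  · exact two_pow_dvd_choose_mul hN hvo ho (by have := hv2 h; omega)
      (two_pow_eight_dvd_eulerDiff i r hi)
  · rcases hv with hv | hv
    · exact two_pow_dvd_choose_mul hN hvo ho hv (two_pow_dvd_eulerDiff i r)
    · exact two_pow_dvd_choose_mul hN hvo ho (by omega)
        (two_pow_nine_dvd_eulerDiff i r (by omega))

theorem cast_choose_two_mul (N : ℕ) : (N.choose 2 : ℤ) * 2 = N * (N - 1) := by
  induction N with
  | zero => simp
  | succ N ih =>
    rw [Nat.choose_succ_succ' N 1, Nat.choose_one_right]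
    push_cast
    linear_combination ih

theorem cast_choose_three_mul (N : ℕ) : (N.choose 3 : ℤ) * 6 = N * (N - 1) * (N - 2) := by
  induction N with
  | zero => simp
  | succ N ih =>
    rw [Nat.choose_succ_succ' N 2]
    push_cast
    linear_combination ih + 3 * cast_choose_two_mul N

theorem cast_choose_four_mul (N : ℕ) :
    (N.choose 4 : ℤ) * 24 = N * (N - 1) * (N - 2) * (N - 3) := by
  induction N with
  | zero => simp
  | succ N ih =>
    rw [Nat.choose_succ_succ' N 3]
    push_cast
    linear_combination ih + 4 * cast_choose_three_mul N

/-- The factor 3 clears the odd part of the denominators of C(N,3) and C(N,4). -/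
theorem three_mul_eulerNumber_sub {m N : ℕ} (hm : 4 ≤ m) (hN : 2 ^ m ∣ N) (hN0 : 0 < N) (r : ℕ) :
    (2 : ℤ) ^ (m + 6) ∣ 3 * (eulerNumber (2 * (r + N)) - eulerNumber (2 * r)) -
      N * (8 * (r * (r + 1)) - 2) := by
  obtain ⟨n, hn⟩ : 16 ∣ N := (pow_dvd_pow 2 hm : 2 ^ 4 ∣ 2 ^ m).trans hN
  have hsum := eulerNumber_two_mul_add r N
  rw [show N + 1 = 5 + (N - 4) by omega, Finset.sum_range_add] at hsum
  have htail : (2 : ℤ) ^ (m + 6) ∣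
      ∑ x ∈ Finset.range (N - 4), (N.choose (5 + x) : ℤ) * eulerDiff (5 + x) r :=
    Finset.dvd_sum fun x _ => two_pow_dvd_choose_mul_eulerDiff hN (by omega) r
  have hN64 : (2 : ℤ) ^ (m + 6) ∣ 64 * N := by
    rw [pow_add, mul_comm]
    exact mul_dvd_mul (by norm_num) (mod_cast hN)
  obtain ⟨a, ha⟩ := (eulerDiff_one_modEq r).symm.dvd
  obtain ⟨b, hb⟩ := (eulerDiff_two_modEq r).symm.dvd
  obtain ⟨c, hc⟩ := (eulerDiff_three_modEq r).symm.dvd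
  obtain ⟨d, hd⟩ := (eulerDiff_four_modEq r).symm.dvd
  have h2 := cast_choose_two_mul N
  have h3 := cast_choose_three_mul N
  have h4 := cast_choose_four_mul N
  have hn' : (N : ℤ) = 16 * n := mod_cast hn
  simp only [Finset.sum_range_succ, Finset.sum_range_zero, Nat.choose_zero_right,
    Nat.choose_one_right, eulerDiff_zero_left] at hsum
  rw [sub_eq_iff_eq_add] at ha hb hc hd
  rw [ha, hb, hc, hd] at hsum
  set T := ∑ x ∈ Finset.range (N - 4), (N.choose (5 + x) : ℤ) * eulerDiff (5 + x) r
  rw [hsum]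
  rw [hn'] at h2 h3 h4 hN64 ⊢
  -- Everything beyond the stated main term is a multiple of 64N; N = 16n makes the quotients of the
  -- higher powers of N integral.
  refine ((htail.mul_left 3).add (hN64.mul_right (3 * a - 3 * b + c - 3 * d - 2 + 4 * r - 2 * r ^ 2 +
    3 * (1 - 10 * r + 16 * b) * n + (4 * c - 1) * (32 * n ^ 2 - 6 * n) +
    (1 + 2 * d) * (1024 * n ^ 3 - 384 * n ^ 2 + 44 * n)))).trans (dvd_of_eq ?_)
  linear_combination (-12 * (1 - 10 * r + 16 * b) : ℤ) * h2 - 8 * (4 * c - 1) * h3 -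
    16 * (1 + 2 * d) * h4

theorem corollary2p3 (b k m : ℕ) (hb : Even b) (hk : 1 ≤ k) (hm : 5 ≤ m) :
    (b ≡ 0 [MOD 16] ∨ b ≡ 14 [MOD 16] →
      eulerNumber (2 ^ m * k + b) ≡ eulerNumber b - 11 * (2 ^ m * (k : ℤ)) [ZMOD 2 ^ (m + 5)]) ∧
    (b ≡ 2 [MOD 16] ∨ b ≡ 12 [MOD 16] →
      eulerNumber (2 ^ m * k + b) ≡ eulerNumber b + 13 * (2 ^ m * (k : ℤ)) [ZMOD 2 ^ (m + 5)]) ∧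
    (b ≡ 4 [MOD 16] ∨ b ≡ 10 [MOD 16] →
      eulerNumber (2 ^ m * k + b) ≡ eulerNumber b - 3 * (2 ^ m * (k : ℤ)) [ZMOD 2 ^ (m + 5)]) ∧
    (b ≡ 6 [MOD 16] ∨ b ≡ 8 [MOD 16] →
      eulerNumber (2 ^ m * k + b) ≡ eulerNumber b + 5 * (2 ^ m * (k : ℤ)) [ZMOD 2 ^ (m + 5)]) := by
  obtain ⟨r, rfl⟩ := hb.two_dvd
  -- The index grows by 2N, so N has one factor 2 less than the increment.
  obtain ⟨m, rfl⟩ : ∃ p, m = p + 1 := ⟨m - 1, by omega⟩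
  have key := three_mul_eulerNumber_sub (m := m) (N := 2 ^ m * k) (by omega) (dvd_mul_right _ _)
    (by positivity) r
  rw [show 2 * (r + 2 ^ m * k) = 2 ^ (m + 1) * k + 2 * r by ring] at key
  have step : ∀ c : ℤ, (32 : ℤ) ∣ 4 * (r * (r + 1)) - 1 - 3 * c →
      eulerNumber (2 ^ (m + 1) * k + 2 * r) ≡
        eulerNumber (2 * r) + c * (2 ^ (m + 1) * (k : ℤ)) [ZMOD 2 ^ (m + 1 + 5)] := by
    rintro c ⟨q, hq⟩
    refine Int.ModEq.symm (Int.modEq_of_dvd ?_)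
    have hcop : IsCoprime ((2 : ℤ) ^ (m + 6)) 3 := IsCoprime.pow_left (by norm_num)
    refine hcop.dvd_of_dvd_mul_left ?_
    have h := key.add (dvd_mul_right ((2 : ℤ) ^ (m + 6)) (k * q))
    refine h.trans (dvd_of_eq ?_)
    push_cast
    linear_combination (-(2 : ℤ) ^ (m + 1) * k) * hq
  have hr : ∀ s : ℕ, 2 * r ≡ 2 * s [MOD 16] →
      (4 * (r * (r + 1)) : ℤ) ≡ 4 * (s * (s + 1)) [ZMOD 32] := by
    intro s hs
    have hs' : r ≡ s [MOD 8] := Nat.ModEq.mul_left_cancel' (c := 2) two_ne_zero hs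
    exact_mod_cast Int.natCast_modEq_iff.2 ((hs'.mul (hs'.add_right 1)).mul_left' 4)
  have hstep : ∀ (c : ℤ) (s : ℕ), 2 * r ≡ 2 * s [MOD 16] →
      (32 : ℤ) ∣ 4 * (s * (s + 1)) - 1 - 3 * c →
      eulerNumber (2 ^ (m + 1) * k + 2 * r) ≡
        eulerNumber (2 * r) + c * (2 ^ (m + 1) * (k : ℤ)) [ZMOD 2 ^ (m + 1 + 5)] := by
    intro c s hs hc
    have := (hr s hs).symm.dvd.add hc
    refine step c (this.trans (dvd_of_eq (by ring)))
  have hneg : ∀ c x y : ℤ, x - c * y = x + (-c) * y := fun c x y => by ring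
  refine ⟨?_, ?_, ?_, ?_⟩
  -- Each c solves 3c ≡ 4s(s+1) - 1 mod 32, with s = b/2 mod 8.
  · rintro (h | h) <;> rw [hneg]
    · exact hstep (-11) 0 h (by norm_num)
    · exact hstep (-11) 7 h (by norm_num)
  · rintro (h | h)
    · exact hstep 13 1 h (by norm_num)
    · exact hstep 13 6 h (by norm_num)
  · rintro (h | h) <;> rw [hneg]
    · exact hstep (-3) 2 h (by norm_num)
    · exact hstep (-3) 5 h (by norm_num)
  · rintro (h | h)
    · exact hstep 5 3 h (by norm_num)
    · exact hstep 5 4 h (by norm_num)
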